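/- Let $S$ be a connected Riemann surface (Hausdorff, second countable) and let $\alpha$ be a holomorphic $1$-form on $S$ that is not identically zero. Away from the zeros of $\alpha$, the local primitives of $\alpha$ are charts to $\mathbb{C}$ that differ locally by translations. Let the area (Lebesgue) measure of $(S,\alpha)$ be the Borel measure that is planar Lebesgue measure in these charts and gives the zeros of $\alpha$ measure $0$, and let the translation flow $F^t$ be the (partially defined) flow given in these charts by $(x,y)\mapsto(x+t,y)$; $F^t$ is undefined at a point whose horizontal trajectory reaches a zero of $\alpha$ or leaves the surface before time $t$. A Borel measure $\mu$ is flow-invariant if $\mu(F^t(A))=\mu(A)$ for all $t\in\mathbb{R}$ and all Borel sets $A$ on which $F^t$ is defined. The flow is ergodic if every Borel set invariant under the flow has zero area or a complement of zero area. Suppose that $(S,\alpha)$ has finite area and infinite topological type (that is, $\pi_1(S)$ is not finitely generated). Let $p:\tilde S\to S$ be an unbranched holomorphic covering of finite degree $d\ge 1$, and let $\tilde\alpha=p^*\alpha$. Suppose that the translation flows of $(S,\alpha)$ and of $(\tilde S,\tilde\alpha)$ are both ergodic. Let $\lambda$ and $\tilde\lambda$ be the area measures of $(S,\alpha)$ and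 $(\tilde S,\tilde\alpha)$, normalized to be probability measures. Then $\tilde\lambda$ is the unique translation flow-invariant Borel measure on $\tilde S$ that projects to $\lambda$: $\tilde\lambda$ is flow-invariant and $p_*\tilde\lambda=\lambda$, and every flow-invariant Borel measure $\mu$ on $\tilde S$ with $p_*\mu=\lambda$ equals $\tilde\lambda$. -/

import Mathlib

open Set Filter Topology MeasureTheory
open scoped Manifold ContDiff

/-- A translation surface: a Riemann surface `S` together with a holomorphic `1`-form. The
Riemann surface is given by the classes on `S`; connectedness is not built in, since
covers may be disconnected. -/
structure TranslationSurface (S : Type*) [TopologicalSpace S] [ChartedSpace ℂ S] where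
  /-- The `1`-form `α`, a complex-linear functional on each tangent space. -/
  form : ∀ x : S, TangentSpace 𝓘(ℂ) x →L[ℂ] ℂ
  /-- In each chart `φ` of the atlas, `α` reads `g(z) dz` with `g` holomorphic. -/
  holomorphic : ∀ φ ∈ atlas ℂ S,
    DifferentiableOn ℂ
      (fun z : ℂ => form (φ.symm z)
        (mfderiv 𝓘(ℂ) 𝓘(ℂ) (φ.symm : ℂ → S) z (1 : ℂ)))
      φ.target
  /-- `α` vanishes identically on no component, equivalently on no non-empty open set. -/
  exists_form_ne_zero : ∀ U : Set S, IsOpen U → U.Nonempty → ∃ x ∈ U, form x ≠ 0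

namespace TranslationSurface

variable {S : Type*} [TopologicalSpace S] [ChartedSpace ℂ S]

/-- `e` is a natural coordinate chart to the plane: a homeomorphism from an open subset of `S`
onto an open subset of `ℂ` that is a local primitive of `α`, that is, `q ↦ ∫_p^q α` up to a
constant. Such charts exist exactly around the points that are not zeros of `α`, and any two
differ locally by a translation. -/
def IsNaturalChart (X : TranslationSurface S) (e : OpenPartialHomeomorph S ℂ) : Prop :=
  ∀ x ∈ e.source, HasMFDerivAt 𝓘(ℂ) 𝓘(ℂ) (e : S → ℂ) x (X.form x)

/-- The area (Lebesgue) measure of the flat metric: the least measure that dominates, for each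
natural chart, the planar Lebesgue measure carried to the surface by that chart. On the
domain of a natural chart it is planar Lebesgue measure, and zeros of `α` have measure zero. -/
noncomputable def area (X : TranslationSurface S) [MeasurableSpace S] : Measure S :=
  ⨆ (e : OpenPartialHomeomorph S ℂ) (_ : X.IsNaturalChart e),
    Measure.map (e.symm : ℂ → S) (volume.restrict e.target)

/-- Lebesgue measure normalized to total mass one (for a surface of finite area). -/
noncomputable def lebesgue (X : TranslationSurface S) [MeasurableSpace S] : Measure S :=
  (X.area univ)⁻¹ • X.area

/-- `γ` moves on the time interval `I` along the translation flow: near each time in `I` it reads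
`(x, y) ↦ (x + t, y)` in a natural chart. In particular it avoids the zeros of `α`. -/
def IsTrajectoryOn (X : TranslationSurface S) (γ : ℝ → S) (I : Set ℝ) : Prop :=
  ∀ s ∈ I, ∃ e : OpenPartialHomeomorph S ℂ, X.IsNaturalChart e ∧ γ s ∈ e.source ∧
    ∀ᶠ r in 𝓝[I] s, γ r ∈ e.source ∧ e (γ r) = e (γ s) + ((r - s : ℝ) : ℂ)

/-- The graph of the translation flow: `F^t x` is defined and equal to `y`. It is undefined
when the horizontal trajectory of `x` reaches a zero of `α` or leaves the surface
before time `t`. -/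
def FlowsTo (X : TranslationSurface S) (t : ℝ) (x y : S) : Prop :=
  ∃ γ : ℝ → S, γ 0 = x ∧ γ t = y ∧ X.IsTrajectoryOn γ (uIcc 0 t)

/-- The set of points at which `F^t` is defined. -/
def flowDomain (X : TranslationSurface S) (t : ℝ) : Set S :=
  {x | ∃ y, X.FlowsTo t x y}

/-- The image `F^t(A)`. -/
def flowImage (X : TranslationSurface S) (t : ℝ) (A : Set S) : Set S :=
  {y | ∃ x ∈ A, X.FlowsTo t x y}

/-- `μ` is invariant under the translation flow: `μ(F^t(A)) = μ(A)` for every time `t` and every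
measurable set `A` on which `F^t` is defined. -/
def IsFlowInvariant (X : TranslationSurface S) [MeasurableSpace S] (μ : Measure S) : Prop :=
  ∀ (t : ℝ) (A : Set S), MeasurableSet A → A ⊆ X.flowDomain t → μ (X.flowImage t A) = μ A

/-- The translation flow is ergodic for Lebesgue measure: every measurable set that is a union
of orbits (and possibly of zeros of `α`) is null or has null complement. -/
def HasErgodicFlow (X : TranslationSurface S) [MeasurableSpace S] : Prop :=
  ∀ A : Set S, MeasurableSet A → (∀ (t : ℝ) (x y : S), X.FlowsTo t x y → (x ∈ A ↔ y ∈ A)) →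
    X.area A = 0 ∨ X.area Aᶜ = 0

/-- `p` is an unbranched cover of finite degree `d ≥ 1` of translation surfaces: a holomorphic
covering map all of whose fibres have `d` points, such that the form upstairs is the
pullback of the form downstairs. -/
structure IsFiniteCover {S' : Type*} [TopologicalSpace S'] [ChartedSpace ℂ S']
    (X' : TranslationSurface S') (X : TranslationSurface S) (p : S' → S) (d : ℕ) : Prop where
  isCoveringMap : IsCoveringMap p
  mdifferentiable : MDifferentiable 𝓘(ℂ) 𝓘(ℂ) p
  degree_pos : 0 < d
  ncard_fiber : ∀ x : S, (p ⁻¹' {x}).ncard = d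
  form_eq : ∀ x : S', X'.form x = (X.form (p x)).comp (mfderiv 𝓘(ℂ) 𝓘(ℂ) p x)

end TranslationSurface

/-- A connected surface has infinite topological type when its fundamental group is not finitely
generated. -/
def HasInfiniteTopologicalType (S : Type*) [TopologicalSpace S] : Prop :=
  ∀ s : S, ¬ Group.FG (FundamentalGroup S s)

/-!
Write `λ'` for the normalized area upstairs and `μ` for an invariant measure with `p_* μ = λ`.

*Absolute continuity.* A finite cover is locally an isometry of the flat metrics, so each of its
sheets carries sets of area zero to sets of area zero. If `A` has area zero, then so has `p '' A`,
and `μ A ≤ μ (p ⁻¹' (p '' A)) = λ (p '' A) = 0`; hence `μ ≪ λ'`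
(`IsFiniteCover.absolutelyContinuous`). The same local picture, with the `d` points of a fibre
counted, gives `p_* area' = d • area` (`IsFiniteCover.map_area`), hence `p_* λ' = λ`, and `μ` and
`λ'` have the same total mass.

*Ergodicity.* Let `f` be the density of `μ` with respect to `λ'`. Since both measures are invariant,
for each `t` almost no point moves between `{f > 1}` and its complement under the time-`t` map
(`IsFlowInvariant.ae_mem_iff`). The flow is only partially defined and ergodicity concerns sets that
are exactly unions of orbits, so `{f > 1}` is replaced by the set of points whose trajectory lies in
it at almost every time; by Fubini's theorem this changes it by a null set only
(`ae_mem_fullOrbits_iff`). Ergodicity upstairs then gives `f ≤ 1` or `f ≥ 1` almost everywhere, and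
equality of the total masses gives `μ = λ'`.

*Flat geometry.* Transition maps between natural charts have derivative `1`; this needs that the
inverse of an injective holomorphic map is holomorphic, which also shows that natural charts descend
along the sheets of the cover. It follows that area is Lebesgue measure in each natural chart
(`IsNaturalChart.area_apply`), that trajectories are unique, and, by propagation along a trajectory,
that the time-`t` map is a translation in natural charts near every point where it is defined
(`FlowsTo.flowsNear`). So area is invariant, and the flow has an open domain in space-time on which
it is continuous.
-/

/-! ### Measures and open partial homeomorphisms -/

theorem ContinuousOn.measurableSet_inter_preimage {α β : Type*} [TopologicalSpace α]
    [MeasurableSpace α] [BorelSpace α] [TopologicalSpace β] [MeasurableSpace β] [BorelSpace β]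
    {f : α → β} {U : Set α} (hf : ContinuousOn f U) (hU : IsOpen U) {B : Set β}
    (hB : MeasurableSet B) : MeasurableSet (U ∩ f ⁻¹' B) := by
  have h := (continuousOn_iff_continuous_domRestrict.1 hf).measurable hB
  convert hU.measurableSet.subtype_image h using 1
  ext x
  simp [and_comm]

theorem OpenPartialHomeomorph.measurableSet_target_inter_symm_preimage
    {M : Type*} [TopologicalSpace M] [MeasurableSpace M] [BorelSpace M]
    (e : OpenPartialHomeomorph M ℂ) {B : Set M} (hB : MeasurableSet B) :
    MeasurableSet (e.target ∩ e.symm ⁻¹' B) :=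
  e.continuousOn_symm.measurableSet_inter_preimage e.open_target hB

theorem OpenPartialHomeomorph.map_symm_volume_apply
    {M : Type*} [TopologicalSpace M] [MeasurableSpace M] [BorelSpace M]
    (e : OpenPartialHomeomorph M ℂ) {B : Set M} (hB : MeasurableSet B) :
    Measure.map e.symm (volume.restrict e.target) B = volume (e.target ∩ e.symm ⁻¹' B) := by
  rw [Measure.map_apply_of_aemeasurable
    (e.continuousOn_symm.aemeasurable e.open_target.measurableSet) hB,
    Measure.restrict_apply' e.open_target.measurableSet, inter_comm]

/-- Measures that agree near each point of a set agree on its subsets: countably many of the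
neighbourhoods suffice to cover it. -/
theorem MeasureTheory.Measure.apply_eq_of_locally_eq {α : Type*} [TopologicalSpace α]
    [SecondCountableTopology α] [MeasurableSpace α] [OpensMeasurableSpace α]
    {m₁ m₂ : Measure α} {W : Set α}
    (h : ∀ x ∈ W, ∃ U, IsOpen U ∧ x ∈ U ∧
      ∀ C, MeasurableSet C → C ⊆ U → m₁ C = m₂ C)
    {B : Set α} (hBW : B ⊆ W) : m₁ B = m₂ B := by
  choose! U hU hxU hm using h
  obtain ⟨T, hT, hTS, hTU⟩ := TopologicalSpace.isOpen_sUnion_countable (U '' W)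
    (by rintro _ ⟨x, hx, rfl⟩; exact hU x hx)
  have hr := (Measure.restrict_sUnion_congr (μ := m₁) (ν := m₂) hT).2 (by
    intro s hs
    obtain ⟨x, hx, rfl⟩ := hTS hs
    refine Measure.ext fun C hC => ?_
    rw [Measure.restrict_apply hC, Measure.restrict_apply hC]
    exact hm x hx _ (hC.inter (hU x hx).measurableSet) inter_subset_right)
  have hBT : B ⊆ ⋃₀ T := by
    rw [hTU]
    exact fun x hx => ⟨U x, ⟨x, hBW hx, rfl⟩, hxU x (hBW hx)⟩
  rw [← Measure.restrict_eq_self m₁ hBT, ← Measure.restrict_eq_self m₂ hBT, hr]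

/-! ### Inverses of injective holomorphic maps -/

/-- An injective holomorphic map has a holomorphic inverse: the inverse is continuous, and
differentiable off the isolated critical values, which are therefore removable. -/
theorem OpenPartialHomeomorph.differentiableAt_symm_of_differentiableOn
    (f : OpenPartialHomeomorph ℂ ℂ) (hf : DifferentiableOn ℂ f f.source) {a : ℂ}
    (ha : a ∈ f.target) : DifferentiableAt ℂ f.symm a := by
  have hx : f.symm a ∈ f.source := f.map_target ha
  have han : AnalyticAt ℂ f (f.symm a) := hf.analyticAt (f.open_source.mem_nhds hx)
  rcases han.deriv.eventually_eq_zero_or_eventually_ne_zero with h | h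
  · exfalso
    -- a vanishing derivative would make `f` constant near `f.symm a`
    obtain ⟨r, hr, hball⟩ := Metric.mem_nhds_iff.1
      (h.and (f.open_source.mem_nhds hx))
    have hconst : ∀ z ∈ Metric.ball (f.symm a) r, f z = f (f.symm a) := by
      intro z hz
      refine (convex_ball _ r).is_const_of_fderivWithin_eq_zero (𝕜 := ℂ)
        (hf.mono fun w hw => (hball hw).2) ?_ hz (Metric.mem_ball_self hr)
      intro w hw
      rw [fderivWithin_of_isOpen Metric.isOpen_ball hw]
      ext
      simpa using (hball hw).1
    have hz : f.symm a + (r / 2 : ℝ) ∈ Metric.ball (f.symm a) r := by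
      simp only [Metric.mem_ball, dist_self_add_left, Complex.norm_real, Real.norm_eq_abs]
      rw [abs_of_pos (by positivity)]
      linarith
    have := f.injOn (hball hz).2 hx (hconst _ hz)
    simp [hr.ne'] at this
  · refine (Complex.analyticAt_of_differentiable_on_punctured_nhds_of_continuousAt ?_
      (f.continuousAt_symm ha)).differentiableAt
    have ht : Tendsto f.symm (𝓝[≠] a) (𝓝[≠] (f.symm a)) := by
      refine tendsto_nhdsWithin_iff.2
        ⟨(f.continuousAt_symm ha).tendsto.mono_left nhdsWithin_le_nhds, ?_⟩
      filter_upwards [self_mem_nhdsWithin,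
        mem_nhdsWithin_of_mem_nhds (f.open_target.mem_nhds ha)] with w hw hwt h
      exact hw (f.symm.injOn hwt ha h)
    filter_upwards [ht.eventually h, mem_nhdsWithin_of_mem_nhds (f.open_target.mem_nhds ha)]
      with w hw hwt
    have hd : DifferentiableAt ℂ f (f.symm w) :=
      hf.differentiableAt (f.open_source.mem_nhds (f.map_target hwt))
    exact (f.hasDerivAt_symm hwt hw hd.hasDerivAt).differentiableAt

/-- A homeomorphism between open subsets of Riemann surfaces that is holomorphic is
biholomorphic. -/
theorem OpenPartialHomeomorph.mdifferentiable_of_mdifferentiableOn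
    {M N : Type*} [TopologicalSpace M] [ChartedSpace ℂ M] [IsManifold 𝓘(ℂ) 1 M]
    [TopologicalSpace N] [ChartedSpace ℂ N] [IsManifold 𝓘(ℂ) 1 N]
    (f : OpenPartialHomeomorph M N) (hf : MDifferentiableOn 𝓘(ℂ) 𝓘(ℂ) f f.source) :
    f.MDifferentiable 𝓘(ℂ) 𝓘(ℂ) := by
  refine ⟨hf, fun y hy => MDifferentiableAt.mdifferentiableWithinAt ?_⟩
  set x := f.symm y with hxdef
  have hx : x ∈ f.source := f.map_target hy
  have hfx : f x = y := f.right_inv hy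
  set c := chartAt ℂ x
  set c' := chartAt ℂ y
  have hxc : x ∈ c.source := mem_chart_source ℂ x
  have hyc : y ∈ c'.source := mem_chart_source ℂ y
  set g : OpenPartialHomeomorph ℂ ℂ := c.symm.trans (f.trans c')
  have hg : DifferentiableOn ℂ g g.source := by
    intro z hz
    have h1 : z ∈ c.target ∧ c.symm z ∈ f.source ∧ f (c.symm z) ∈ c'.source := by
      simpa [g] using hz
    have h2 : MDifferentiableAt 𝓘(ℂ) 𝓘(ℂ) (c' ∘ (f ∘ c.symm)) z := by
      refine MDifferentiableAt.comp (I' := 𝓘(ℂ)) z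
        ((mdifferentiable_chart y).mdifferentiableAt h1.2.2)
        (MDifferentiableAt.comp (I' := 𝓘(ℂ)) z ?_
          ((mdifferentiable_chart x).mdifferentiableAt_symm h1.1))
      exact hf.mdifferentiableAt (f.open_source.mem_nhds h1.2.1)
    exact (mdifferentiableAt_iff_differentiableAt.1 h2).differentiableWithinAt
  have hgt : c' y ∈ g.target := by
    have : c x ∈ g.source := by simp [g, c.left_inv hxc, hx, hfx, hyc, c.map_source hxc]
    have h := g.map_source this
    simpa [g, c.left_inv hxc, hfx] using h
  have hgs : MDifferentiableAt 𝓘(ℂ) 𝓘(ℂ) g.symm (c' y) :=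
    mdifferentiableAt_iff_differentiableAt.2
      (g.differentiableAt_symm_of_differentiableOn hg hgt)
  have hgy : g.symm (c' y) ∈ c.target := (g.map_target hgt).1
  have h3 : MDifferentiableAt 𝓘(ℂ) 𝓘(ℂ) (c.symm ∘ (g.symm ∘ c')) y :=
    MDifferentiableAt.comp (I' := 𝓘(ℂ)) y ((mdifferentiable_chart x).mdifferentiableAt_symm hgy)
      (MDifferentiableAt.comp (I' := 𝓘(ℂ)) y hgs ((mdifferentiable_chart y).mdifferentiableAt hyc))
  refine h3.congr_of_eventuallyEq ?_
  have hcont : ContinuousAt f.symm y := f.continuousAt_symm hy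
  filter_upwards [c'.open_source.mem_nhds hyc, hcont (c.open_source.mem_nhds hxc)] with w hw hw'
  have : f.symm w ∈ c.source := hw'
  simp [g, c'.left_inv hw, c.left_inv this]

namespace TranslationSurface

variable {S : Type*} [TopologicalSpace S] [ChartedSpace ℂ S]

/-! ### Natural charts -/

/-- The points around which there is a natural chart; its complement is the zero set of `α`. -/
def regularSet (X : TranslationSurface S) : Set S :=
  {x | ∃ e : OpenPartialHomeomorph S ℂ, X.IsNaturalChart e ∧ x ∈ e.source}

theorem isOpen_regularSet (X : TranslationSurface S) : IsOpen X.regularSet := by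
  refine isOpen_iff_mem_nhds.2 fun x ⟨e, he, hx⟩ => ?_
  exact mem_of_superset (e.open_source.mem_nhds hx) fun y hy => ⟨e, he, hy⟩

/-- The zeros of `α` have area zero. -/
theorem area_compl_regularSet [MeasurableSpace S] [BorelSpace S]
    (X : TranslationSurface S) : X.area X.regularSetᶜ = 0 := by
  have hR := X.isOpen_regularSet.measurableSet
  have hle : X.area ≤ X.area.restrict X.regularSet := by
    refine iSup₂_le fun e he => Measure.le_iff.2 fun C hC => ?_
    rw [Measure.restrict_apply hC, e.map_symm_volume_apply hC]
    refine le_trans (measure_mono fun z hz => ?_) ((e.map_symm_volume_apply (hC.inter hR)).symm.le.trans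
      ((le_iSup₂ (f := fun (e : OpenPartialHomeomorph S ℂ) (_ : X.IsNaturalChart e) =>
        Measure.map (e.symm : ℂ → S) (volume.restrict e.target)) e he) _))
    exact ⟨hz.1, hz.2, e, he, e.map_target hz.1⟩
  refine le_antisymm ((hle _).trans ?_) bot_le
  simp [Measure.restrict_apply hR.compl]

variable [IsManifold 𝓘(ℂ) 1 S] {X : TranslationSurface S}

theorem IsNaturalChart.mdifferentiable {e : OpenPartialHomeomorph S ℂ}
    (he : X.IsNaturalChart e) : e.MDifferentiable 𝓘(ℂ) 𝓘(ℂ) :=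
  e.mdifferentiable_of_mdifferentiableOn fun x hx =>
    (he x hx).mdifferentiableAt.mdifferentiableWithinAt

/-- The transition map between natural charts has derivative `1`. -/
theorem IsNaturalChart.hasDerivAt_transition {e₁ e₂ : OpenPartialHomeomorph S ℂ}
    (h₁ : X.IsNaturalChart e₁) (h₂ : X.IsNaturalChart e₂) {z : ℂ}
    (hz : z ∈ (e₁.symm.trans e₂).source) : HasDerivAt (e₁.symm.trans e₂) 1 z := by
  have hz' : z ∈ e₁.target ∧ e₁.symm z ∈ e₂.source := by simpa using hz
  have hs := (h₁.mdifferentiable.mdifferentiableAt_symm hz'.1).hasMFDerivAt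
  have ha := (h₂ _ hz'.2).comp z hs
  have hb := (h₁ _ (e₁.map_target hz'.1)).comp z hs
  have hid : HasMFDerivAt 𝓘(ℂ) 𝓘(ℂ) (e₁ ∘ e₁.symm) z
      (ContinuousLinearMap.id ℂ (TangentSpace 𝓘(ℂ) z)) := by
    refine (hasMFDerivAt_id z).congr_of_eventuallyEq ?_
    filter_upwards [e₁.open_target.mem_nhds hz'.1] with w hw
    simp [e₁.right_inv hw]
  have heq := hasMFDerivAt_unique hb hid
  have hf : HasFDerivAt (e₂ ∘ e₁.symm) (ContinuousLinearMap.id ℂ ℂ) z :=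
    hasMFDerivAt_iff_hasFDerivAt.1 (ha.congr_mfderiv heq)
  exact hf.hasDerivAt

/-- Two natural charts differ locally by a translation. -/
theorem IsNaturalChart.eventually_sub_eq {e₁ e₂ : OpenPartialHomeomorph S ℂ}
    (h₁ : X.IsNaturalChart e₁) (h₂ : X.IsNaturalChart e₂) {x : S}
    (hx₁ : x ∈ e₁.source) (hx₂ : x ∈ e₂.source) :
    ∀ᶠ y in 𝓝 x, e₂ y - e₂ x = e₁ y - e₁ x := by
  set g := e₁.symm.trans e₂ with hg
  have hxg : e₁ x ∈ g.source := by simp [hg, hx₁, hx₂]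
  obtain ⟨r, hr, hball⟩ := Metric.isOpen_iff.1 g.open_source _ hxg
  have hconst : ∀ z ∈ Metric.ball (e₁ x) r, g z - z = g (e₁ x) - e₁ x := by
    intro z hz
    have hd : ∀ w ∈ Metric.ball (e₁ x) r, HasDerivAt (fun w => g w - w) 0 w := by
      intro w hw
      have h := (h₁.hasDerivAt_transition h₂ (hball hw)).sub (hasDerivAt_id w)
      rwa [sub_self] at h
    refine (convex_ball (e₁ x) r).is_const_of_fderivWithin_eq_zero (𝕜 := ℂ)
      (f := fun w => g w - w)
      (fun w hw => (hd w hw).differentiableAt.differentiableWithinAt) ?_ hz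
      (Metric.mem_ball_self hr)
    intro w hw
    rw [fderivWithin_of_isOpen Metric.isOpen_ball hw]
    ext
    simpa using (hd w hw).deriv
  filter_upwards [e₁.open_source.mem_nhds hx₁,
    (e₁.continuousAt hx₁) (Metric.ball_mem_nhds _ hr)] with y hy hy'
  have := hconst _ hy'
  simp only [hg, OpenPartialHomeomorph.coe_trans, Function.comp_apply, e₁.left_inv hy,
    e₁.left_inv hx₁] at this
  linear_combination this

/-! ### The area measure in a natural chart -/

section Area

variable [MeasurableSpace S] [BorelSpace S]

/-- Lebesgue measure of a set read in two natural charts is the same, by the change of variables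
formula: the transition map has derivative `1`. -/
theorem IsNaturalChart.volume_eq {e₁ e₂ : OpenPartialHomeomorph S ℂ}
    (h₁ : X.IsNaturalChart e₁) (h₂ : X.IsNaturalChart e₂) {B : Set S} (hB : MeasurableSet B)
    (hB₁ : B ⊆ e₁.source) (hB₂ : B ⊆ e₂.source) :
    volume (e₁.target ∩ e₁.symm ⁻¹' B) = volume (e₂.target ∩ e₂.symm ⁻¹' B) := by
  set A := e₁.target ∩ e₁.symm ⁻¹' B with hA
  set g := e₁.symm.trans e₂ with hg
  have hAg : A ⊆ g.source := fun z hz => by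
    simpa [hg] using And.intro hz.1 (hB₂ hz.2)
  have himg : g '' A = e₂.target ∩ e₂.symm ⁻¹' B := by
    ext w
    constructor
    · rintro ⟨z, hz, rfl⟩
      have h := hB₂ hz.2
      refine ⟨e₂.map_source h, ?_⟩
      have : e₂.symm (e₂ (e₁.symm z)) ∈ B := by rw [e₂.left_inv h]; exact hz.2
      simpa [hg] using this
    · rintro ⟨hw, hwB⟩
      have h := hB₁ hwB
      refine ⟨e₁ (e₂.symm w), ⟨e₁.map_source h, ?_⟩, ?_⟩
      · rw [mem_preimage, e₁.left_inv h]; exact hwB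
      · simp [hg, e₁.left_inv h, e₂.right_inv hw]
  rw [← himg, ← lintegral_abs_det_fderiv_eq_addHaar_image volume
    (e₁.measurableSet_target_inter_symm_preimage hB)
    (f' := fun _ => ContinuousLinearMap.id ℝ ℂ) (fun z hz => ?_) (g.injOn.mono hAg)]
  · simp [ContinuousLinearMap.det, hA]
  · have h := (h₁.hasDerivAt_transition h₂ (hAg hz)).hasFDerivAt.restrictScalars ℝ
    refine HasFDerivAt.hasFDerivWithinAt (h.congr_fderiv ?_)
    ext
    all_goals simp

/-- On the domain of a natural chart, area is planar Lebesgue measure read in that chart. -/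
theorem IsNaturalChart.area_apply {e : OpenPartialHomeomorph S ℂ} (he : X.IsNaturalChart e)
    {B : Set S} (hB : MeasurableSet B) (hBe : B ⊆ e.source) :
    X.area B = volume (e.target ∩ e.symm ⁻¹' B) := by
  refine le_antisymm ?_ ?_
  · -- the measure equal to the chart measure inside `e.source` and to area outside dominates
    -- every chart measure, hence area
    have hle : X.area ≤ Measure.map e.symm (volume.restrict e.target) +
        X.area.restrict e.sourceᶜ := by
      refine iSup₂_le fun e' he' => Measure.le_iff.2 fun C hC => ?_
      have hm := e.open_source.measurableSet
      rw [← measure_inter_add_sdiff C hm, Measure.add_apply,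
        Measure.restrict_apply hC, ← sdiff_eq]
      refine add_le_add ?_ ?_
      · rw [e'.map_symm_volume_apply (hC.inter hm)]
        calc volume (e'.target ∩ e'.symm ⁻¹' (C ∩ e.source))
            = volume (e'.target ∩ e'.symm ⁻¹' (C ∩ e.source ∩ e'.source)) := by
              congr 1
              ext z
              simp only [mem_inter_iff, mem_preimage]
              exact ⟨fun h => ⟨h.1, h.2, e'.map_target h.1⟩, fun h => ⟨h.1, h.2.1⟩⟩
          _ = volume (e.target ∩ e.symm ⁻¹' (C ∩ e.source ∩ e'.source)) :=
              he'.volume_eq he ((hC.inter hm).inter e'.open_source.measurableSet)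
                inter_subset_right fun x hx => hx.1.2
          _ ≤ Measure.map e.symm (volume.restrict e.target) C := by
              rw [e.map_symm_volume_apply hC]
              exact measure_mono fun z hz => ⟨hz.1, hz.2.1.1⟩
      · exact (le_iSup₂ (f := fun (e : OpenPartialHomeomorph S ℂ) (_ : X.IsNaturalChart e) =>
          Measure.map (e.symm : ℂ → S) (volume.restrict e.target)) e' he') _
    refine (hle B).trans ?_
    rw [Measure.add_apply, e.map_symm_volume_apply hB, Measure.restrict_apply hB]
    have : B ∩ e.sourceᶜ = ∅ := by
      rw [← sdiff_eq, sdiff_eq_empty]; exact hBe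
    simp [this]
  · rw [← e.map_symm_volume_apply hB]
    exact (le_iSup₂ (f := fun (e : OpenPartialHomeomorph S ℂ) (_ : X.IsNaturalChart e) =>
      Measure.map (e.symm : ℂ → S) (volume.restrict e.target)) e he) _

end Area

/-! ### Trajectories of the translation flow -/

section Trajectories

variable {S : Type*} [TopologicalSpace S] [ChartedSpace ℂ S] {X : TranslationSurface S}

theorem IsTrajectoryOn.mono {γ : ℝ → S} {I J : Set ℝ} (h : X.IsTrajectoryOn γ J) (hIJ : I ⊆ J) :
    X.IsTrajectoryOn γ I := fun s hs => by
  obtain ⟨e, he, hse, hev⟩ := h s (hIJ hs)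
  exact ⟨e, he, hse, hev.filter_mono (nhdsWithin_mono _ hIJ)⟩

theorem IsTrajectoryOn.congr {γ γ' : ℝ → S} {I : Set ℝ} (h : X.IsTrajectoryOn γ I)
    (hγ : EqOn γ γ' I) : X.IsTrajectoryOn γ' I := fun s hs => by
  obtain ⟨e, he, hse, hev⟩ := h s hs
  refine ⟨e, he, hγ hs ▸ hse, ?_⟩
  filter_upwards [hev, self_mem_nhdsWithin] with r hr hrI
  rwa [← hγ hrI, ← hγ hs]

theorem IsTrajectoryOn.comp_add_right {γ : ℝ → S} {I : Set ℝ} (h : X.IsTrajectoryOn γ I) (c : ℝ) :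
    X.IsTrajectoryOn (fun r => γ (r + c)) ((· + c) ⁻¹' I) := fun s hs => by
  obtain ⟨e, he, hse, hev⟩ := h (s + c) hs
  refine ⟨e, he, hse, ?_⟩
  have ht : Tendsto (· + c) (𝓝[(· + c) ⁻¹' I] s) (𝓝[I] (s + c)) :=
    ((continuous_add_const c).continuousWithinAt.tendsto_nhdsWithin fun _ hr => hr)
  filter_upwards [ht.eventually hev] with r hr
  simpa using hr

theorem IsTrajectoryOn.continuousOn {γ : ℝ → S} {I : Set ℝ} (h : X.IsTrajectoryOn γ I) :
    ContinuousOn γ I := fun s hs => by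
  obtain ⟨e, he, hse, hev⟩ := h s hs
  have hc : ContinuousAt (fun r : ℝ => e.symm (e (γ s) + ((r - s : ℝ) : ℂ))) s := by
    refine ContinuousAt.comp (g := e.symm) ?_ (by fun_prop)
    simpa using e.continuousAt_symm (e.map_source hse)
  refine hc.continuousWithinAt.congr_of_eventuallyEq ?_ (by simp [e.left_inv hse])
  filter_upwards [hev] with r hr
  rw [← hr.2, e.left_inv hr.1]

theorem FlowsTo.left_mem_regularSet {t : ℝ} {x y : S} (h : X.FlowsTo t x y) :
    x ∈ X.regularSet := by
  obtain ⟨γ, rfl, -, hγ⟩ := h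
  obtain ⟨e, he, hx, -⟩ := hγ 0 left_mem_uIcc
  exact ⟨e, he, hx⟩

theorem FlowsTo.symm {t : ℝ} {x y : S} (h : X.FlowsTo t x y) : X.FlowsTo (-t) y x := by
  obtain ⟨γ, rfl, rfl, hγ⟩ := h
  refine ⟨fun r => γ (r + t), by simp, by simp, (hγ.comp_add_right t).mono ?_⟩
  simp [uIcc_comm]

theorem FlowsTo.right_mem_regularSet {t : ℝ} {x y : S} (h : X.FlowsTo t x y) :
    y ∈ X.regularSet := h.symm.left_mem_regularSet

/-- In a disc of a natural chart the flow is `(x, y) ↦ (x + t, y)`. -/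
theorem IsNaturalChart.flowsTo {e : OpenPartialHomeomorph S ℂ} (he : X.IsNaturalChart e)
    {c : ℂ} {ρ : ℝ} (hball : Metric.ball c ρ ⊆ e.target) {x : S} (hx : x ∈ e.source) {t : ℝ}
    (hxc : e x ∈ Metric.ball c ρ) (htc : e x + (t : ℂ) ∈ Metric.ball c ρ) :
    X.FlowsTo t x (e.symm (e x + t)) := by
  refine ⟨fun r => e.symm (e x + r), by simp [e.left_inv hx], rfl, ?_⟩
  have hseg : ∀ r ∈ uIcc 0 t, e x + (r : ℂ) ∈ e.target := by
    intro r hr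
    refine hball ?_
    have hconv : Convex ℝ ((fun r : ℝ => e x + (r : ℂ)) ⁻¹' Metric.ball c ρ) := by
      intro a ha b hb p q hp hq hpq
      have := (convex_ball c ρ) ha hb hp hq hpq
      have hpq' : (p : ℂ) + q = 1 := by exact_mod_cast hpq
      have heq : e x + ((p • a + q • b : ℝ) : ℂ) = p • (e x + (a : ℂ)) + q • (e x + (b : ℂ)) := by
        simp only [smul_eq_mul, Complex.ofReal_add, Complex.ofReal_mul, Complex.real_smul]
        linear_combination (-e x) * hpq'
      rw [mem_preimage, heq]
      exact this
    exact hconv.ordConnected.uIcc_subset (by simpa using hxc) htc hr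
  intro s hs
  refine ⟨e, he, e.map_target (hseg s hs), ?_⟩
  filter_upwards [self_mem_nhdsWithin] with r hr
  refine ⟨e.map_target (hseg r hr), ?_⟩
  rw [e.right_inv (hseg r hr), e.right_inv (hseg s hs)]
  push_cast
  ring

theorem FlowsTo.refl {x : S} (hx : x ∈ X.regularSet) : X.FlowsTo 0 x x := by
  obtain ⟨e, he, hx⟩ := hx
  obtain ⟨ρ, hρ, hball⟩ := Metric.isOpen_iff.1 e.open_target _ (e.map_source hx)
  have h := he.flowsTo hball hx (t := 0) (Metric.mem_ball_self hρ) (by simpa using hρ)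
  simpa [e.left_inv hx] using h

end Trajectories

/-- A trajectory moves by `(x, y) ↦ (x + t, y)` in every natural chart, not only in the one that
witnesses it, since natural charts differ by translations. -/
theorem IsTrajectoryOn.eventually_chart {γ : ℝ → S} {I : Set ℝ} (h : X.IsTrajectoryOn γ I) {s : ℝ}
    (hs : s ∈ I) {e : OpenPartialHomeomorph S ℂ} (he : X.IsNaturalChart e) (hse : γ s ∈ e.source) :
    ∀ᶠ r in 𝓝[I] s, γ r ∈ e.source ∧ e (γ r) = e (γ s) + ((r - s : ℝ) : ℂ) := by
  obtain ⟨e', he', hse', hev⟩ := h s hs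
  have hc := (h.continuousOn s hs).tendsto
  filter_upwards [hev, hc.eventually (e.open_source.mem_nhds hse),
    hc.eventually (he'.eventually_sub_eq he hse' hse)] with r hr hrs hre
  exact ⟨hrs, by linear_combination hre + hr.2⟩

theorem IsTrajectoryOn.union {γ : ℝ → S} {I J : Set ℝ} (hI : X.IsTrajectoryOn γ I)
    (hJ : X.IsTrajectoryOn γ J) (hIc : IsClosed I) (hJc : IsClosed J) :
    X.IsTrajectoryOn γ (I ∪ J) := by
  have key : ∀ {K : Set ℝ}, X.IsTrajectoryOn γ K → IsClosed K →
      ∀ {e : OpenPartialHomeomorph S ℂ} {s : ℝ}, X.IsNaturalChart e → γ s ∈ e.source →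
        ∀ᶠ r in 𝓝[K] s, γ r ∈ e.source ∧ e (γ r) = e (γ s) + ((r - s : ℝ) : ℂ) := by
    intro K hK hKc e s he hse
    by_cases hs : s ∈ K
    · exact hK.eventually_chart hs he hse
    · rw [notMem_closure_iff_nhdsWithin_eq_bot.1 (by rwa [hKc.closure_eq])]
      exact eventually_bot
  intro s hs
  obtain ⟨e, he, hse⟩ : ∃ e : OpenPartialHomeomorph S ℂ, X.IsNaturalChart e ∧ γ s ∈ e.source := by
    rcases hs with hs | hs
    · obtain ⟨e, he, hse, -⟩ := hI s hs
      exact ⟨e, he, hse⟩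
    · obtain ⟨e, he, hse, -⟩ := hJ s hs
      exact ⟨e, he, hse⟩
  refine ⟨e, he, hse, ?_⟩
  rw [nhdsWithin_union]
  exact eventually_sup.2 ⟨key hI hIc he hse, key hJ hJc he hse⟩

/-- Trajectories that meet at one time coincide: the set of times at which they agree is open by
comparison in a natural chart, and closed since the surface is Hausdorff. -/
theorem IsTrajectoryOn.eqOn [T2Space S] {γ γ' : ℝ → S} {I : Set ℝ} (h : X.IsTrajectoryOn γ I)
    (h' : X.IsTrajectoryOn γ' I) (hI : IsPreconnected I) {s : ℝ} (hs : s ∈ I)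
    (heq : γ s = γ' s) : EqOn γ γ' I := by
  intro r hr
  refine (hI.induction₂ (fun a b => γ a = γ' a ↔ γ b = γ' b) (fun a ha => ?_)
    (fun _ _ _ _ _ _ h₁ h₂ => h₁.trans h₂) (fun _ _ _ _ h₁ => h₁.symm) hs hr).1 heq
  by_cases hab : γ a = γ' a
  · obtain ⟨e, he, hae, hev⟩ := h a ha
    filter_upwards [hev, h'.eventually_chart ha he (hab ▸ hae)] with b hb hb'
    refine iff_of_true hab (e.injOn hb.1 hb'.1 ?_)
    rw [hb.2, hb'.2, hab]
  · filter_upwards [((h.continuousOn a ha).prodMk (h'.continuousOn a ha)).tendsto.eventually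
      (isClosed_diagonal.isOpen_compl.mem_nhds hab)] with b hb
    exact iff_of_false hab hb

/-! ### The translation flow -/

theorem FlowsTo.unique [T2Space S] {t : ℝ} {x y y' : S} (h : X.FlowsTo t x y)
    (h' : X.FlowsTo t x y') : y = y' := by
  obtain ⟨γ, h0, rfl, hγ⟩ := h
  obtain ⟨γ', h0', rfl, hγ'⟩ := h'
  exact hγ.eqOn hγ' isPreconnected_uIcc left_mem_uIcc (h0.trans h0'.symm) right_mem_uIcc

theorem FlowsTo.trans [T2Space S] {s t : ℝ} {x y z : S} (h : X.FlowsTo s x y)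
    (h' : X.FlowsTo t y z) : X.FlowsTo (s + t) x z := by
  classical
  obtain ⟨γ, hx, hy, hγ⟩ := h
  obtain ⟨γ₀, hy', hz, hγ₀⟩ := h'
  have hγ' : X.IsTrajectoryOn (fun r => γ₀ (r + -s)) (uIcc s (s + t)) :=
    (hγ₀.comp_add_right (-s)).mono (by simp [add_comm t s])
  -- when `s` and `t` have opposite signs the two arcs overlap, and agree there by uniqueness
  have hagree : EqOn γ (fun r => γ₀ (r + -s)) (uIcc 0 s ∩ uIcc s (s + t)) :=
    (hγ.mono inter_subset_left).eqOn (hγ'.mono inter_subset_right)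
      (ordConnected_uIcc.inter ordConnected_uIcc).isPreconnected
      ⟨right_mem_uIcc, left_mem_uIcc⟩ (by simp [hy, hy'])
  set δ : ℝ → S := (uIcc 0 s).piecewise γ (fun r => γ₀ (r + -s)) with hδ
  have h₁ : EqOn γ δ (uIcc 0 s) := fun r hr => by simp [hδ, hr]
  have h₂ : EqOn (fun r => γ₀ (r + -s)) δ (uIcc s (s + t)) := fun r hr => by
    by_cases hr' : r ∈ uIcc 0 s
    · rw [← h₁ hr', hagree ⟨hr', hr⟩]
    · simp only [hδ, piecewise_eq_of_notMem _ _ _ hr']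
  refine ⟨δ, ?_, ?_, ((hγ.congr h₁).union (hγ'.congr h₂) isClosed_Icc isClosed_Icc).mono
    uIcc_subset_uIcc_union_uIcc⟩
  · rw [← h₁ left_mem_uIcc, hx]
  · rw [← h₂ right_mem_uIcc]
    simpa using hz

/-- Near `x`, the time-`t` map is defined, takes values near `y`, and is a translation in natural
charts. -/
def FlowsNear (X : TranslationSurface S) (t : ℝ) (x y : S) : Prop :=
  ∃ g : S → S, Tendsto g (𝓝 x) (𝓝 y) ∧ (∀ᶠ u in 𝓝 x, X.FlowsTo t u (g u)) ∧
    ∀ e e' : OpenPartialHomeomorph S ℂ, X.IsNaturalChart e → X.IsNaturalChart e' →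
      x ∈ e.source → y ∈ e'.source → ∀ᶠ u in 𝓝 x, e' (g u) - e' y = e u - e x

theorem FlowsNear.trans [T2Space S] {s t : ℝ} {x y z : S} (h : X.FlowsNear s x y)
    (h' : X.FlowsNear t y z) : X.FlowsNear (s + t) x z := by
  obtain ⟨g, hg, hgf, hge⟩ := h
  obtain ⟨g', hg', hgf', hge'⟩ := h'
  obtain ⟨e', he', hy⟩ := hgf'.self_of_nhds.left_mem_regularSet
  refine ⟨g' ∘ g, hg'.comp hg, ?_, fun e e'' he he'' hx hz => ?_⟩
  · filter_upwards [hgf, hg.eventually hgf'] with u hu hu'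
    exact hu.trans hu'
  · filter_upwards [hge e e' he he' hx hy, hg.eventually (hge' e' e'' he' he'' hy hz)] with u hu hu'
    exact hu'.trans hu

theorem IsNaturalChart.flowsNear {e : OpenPartialHomeomorph S ℂ} (he : X.IsNaturalChart e)
    {c : ℂ} {ρ : ℝ} (hball : Metric.ball c ρ ⊆ e.target) {x y : S} (hx : x ∈ e.source)
    (hy : y ∈ e.source) {t : ℝ} (hxc : e x ∈ Metric.ball c ρ) (hyc : e y ∈ Metric.ball c ρ)
    (hxy : e y = e x + t) : X.FlowsNear t x y := by
  have hyt := e.map_source hy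
  have hc : ContinuousAt (fun u => e u + (t : ℂ)) x :=
    (e.continuousAt hx).add continuousAt_const
  have hg : Tendsto (fun u => e.symm (e u + t)) (𝓝 x) (𝓝 y) := by
    have h : ContinuousAt e.symm (e x + t) := hxy ▸ e.continuousAt_symm hyt
    have h' := h.tendsto.comp hc.tendsto
    rwa [← hxy, e.left_inv hy] at h'
  refine ⟨fun u => e.symm (e u + t), hg, ?_, fun f f' hf hf' hxf hyf => ?_⟩
  · filter_upwards [e.open_source.mem_nhds hx, (e.continuousAt hx) (Metric.isOpen_ball.mem_nhds hxc),
      hc (Metric.isOpen_ball.mem_nhds (by simpa only [hxy] using hyc))] with u hu hu' hu''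
    exact he.flowsTo hball hu hu' hu''
  · filter_upwards [hg.eventually (he.eventually_sub_eq hf' hy hyf), he.eventually_sub_eq hf hx hxf,
      hc (e.open_target.mem_nhds (by simpa only [hxy] using hyt))] with u hu hu' hu''
    rw [hu, hu', e.right_inv hu'', hxy]
    ring

/-- The time-`t` map is a translation in natural charts near each point where it is defined: this
holds for short times, and it propagates along the trajectory. -/
theorem FlowsTo.flowsNear [T2Space S] {t : ℝ} {x y : S} (h : X.FlowsTo t x y) :
    X.FlowsNear t x y := by
  obtain ⟨γ, rfl, rfl, hγ⟩ := h
  suffices h : X.FlowsNear (t - 0) (γ 0) (γ t) by simpa using h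
  refine isPreconnected_uIcc.induction₂' (fun r s => X.FlowsNear (s - r) (γ r) (γ s))
    (fun r hr => ?_) (fun a b c _ _ _ h₁ h₂ => ?_) (left_mem_uIcc (a := 0) (b := t)) right_mem_uIcc
  · obtain ⟨e, he, hre, hev⟩ := hγ r hr
    obtain ⟨ρ, hρ, hball⟩ := Metric.isOpen_iff.1 e.open_target _ (e.map_source hre)
    have hc := ((e.continuousAt hre).tendsto.comp (hγ.continuousOn r hr).tendsto).eventually
      (Metric.ball_mem_nhds _ hρ)
    filter_upwards [hev, hc] with s hs hsb
    refine ⟨he.flowsNear hball hre hs.1 (Metric.mem_ball_self hρ) hsb hs.2,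
      he.flowsNear hball hs.1 hre hsb (Metric.mem_ball_self hρ) ?_⟩
    rw [hs.2]
    push_cast
    ring
  · have := h₁.trans h₂
    rwa [sub_add_sub_cancel' ] at this

/-- The flow is defined and jointly continuous in time and space on an open set. -/
theorem FlowsTo.exists_tendsto [T2Space S] {t : ℝ} {x y : S} (h : X.FlowsTo t x y) :
    ∃ G : ℝ × S → S, Tendsto G (𝓝 (t, x)) (𝓝 y) ∧
      ∀ᶠ q in 𝓝 (t, x), X.FlowsTo q.1 q.2 (G q) := by
  obtain ⟨g, hg, hgf, -⟩ := h.flowsNear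
  obtain ⟨e, he, hye⟩ := h.right_mem_regularSet
  obtain ⟨ρ, hρ, hball⟩ := Metric.isOpen_iff.1 e.open_target _ (e.map_source hye)
  have hsnd : Tendsto Prod.snd (𝓝 (t, x)) (𝓝 x) := continuous_snd.tendsto (t, x)
  have hfst : Tendsto Prod.fst (𝓝 (t, x)) (𝓝 t) := continuous_fst.tendsto (t, x)
  have hg' : Tendsto (fun q : ℝ × S => g q.2) (𝓝 (t, x)) (𝓝 y) := hg.comp hsnd
  have heg : Tendsto (fun q : ℝ × S => e (g q.2)) (𝓝 (t, x)) (𝓝 (e y)) :=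
    (e.continuousAt hye).tendsto.comp hg'
  have ht : Tendsto (fun q : ℝ × S => e (g q.2) + ((q.1 - t : ℝ) : ℂ)) (𝓝 (t, x)) (𝓝 (e y)) := by
    have h0 : Tendsto (fun q : ℝ × S => ((q.1 - t : ℝ) : ℂ)) (𝓝 (t, x)) (𝓝 0) := by
      have := (Complex.continuous_ofReal.tendsto (t - t)).comp (hfst.sub_const t)
      rwa [sub_self, Complex.ofReal_zero] at this
    simpa using heg.add h0
  refine ⟨fun q => e.symm (e (g q.2) + ((q.1 - t : ℝ) : ℂ)), ?_, ?_⟩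
  · have := (e.continuousAt_symm (e.map_source hye)).tendsto.comp ht
    rwa [e.left_inv hye] at this
  · filter_upwards [hsnd.eventually hgf, hg'.eventually (e.open_source.mem_nhds hye),
      heg.eventually (Metric.ball_mem_nhds _ hρ), ht.eventually (Metric.ball_mem_nhds _ hρ)]
      with q h₁ h₂ h₃ h₄
    have := h₁.trans (he.flowsTo hball h₂ h₃ h₄)
    rwa [add_sub_cancel] at this

open Classical in
/-- The time-`t` map of the translation flow as a total function, the identity where the flow is
undefined. -/
noncomputable def flowMap (X : TranslationSurface S) (t : ℝ) (x : S) : S :=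
  if h : ∃ y, X.FlowsTo t x y then h.choose else x

theorem FlowsTo.flowMap_eq [T2Space S] {t : ℝ} {x y : S} (h : X.FlowsTo t x y) :
    X.flowMap t x = y := by
  have hex : ∃ y, X.FlowsTo t x y := ⟨y, h⟩
  rw [flowMap, dif_pos hex]
  exact hex.choose_spec.unique h

/-- The domain of the flow in space-time. -/
def flowSet (X : TranslationSurface S) : Set (ℝ × S) := {q | q.2 ∈ X.flowDomain q.1}

theorem isOpen_flowSet [T2Space S] (X : TranslationSurface S) : IsOpen X.flowSet := by
  refine isOpen_iff_mem_nhds.2 fun q ⟨y, hy⟩ => ?_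
  obtain ⟨G, -, hG⟩ := hy.exists_tendsto
  filter_upwards [hG] with r hr using ⟨_, hr⟩

theorem continuousOn_flowMap [T2Space S] (X : TranslationSurface S) :
    ContinuousOn (fun q : ℝ × S => X.flowMap q.1 q.2) X.flowSet := by
  rintro q ⟨y, hy⟩
  obtain ⟨G, hG, hGf⟩ := hy.exists_tendsto
  refine ContinuousAt.continuousWithinAt ?_
  rw [ContinuousAt, hy.flowMap_eq]
  exact hG.congr' (hGf.mono fun r hr => hr.flowMap_eq.symm)

theorem isOpen_flowDomain [T2Space S] (X : TranslationSurface S) (t : ℝ) :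
    IsOpen (X.flowDomain t) :=
  X.isOpen_flowSet.preimage (Continuous.prodMk_right t)

theorem continuousOn_flowMap_right [T2Space S] (X : TranslationSurface S) (t : ℝ) :
    ContinuousOn (X.flowMap t) (X.flowDomain t) :=
  X.continuousOn_flowMap.comp (Continuous.prodMk_right t).continuousOn fun _ hx => hx

theorem flowImage_eq [T2Space S] (X : TranslationSurface S) (t : ℝ) (A : Set S) :
    X.flowImage t A = X.flowDomain (-t) ∩ X.flowMap (-t) ⁻¹' A := by
  ext y
  constructor
  · rintro ⟨x, hx, hxy⟩
    exact ⟨⟨x, hxy.symm⟩, by rwa [mem_preimage, hxy.symm.flowMap_eq]⟩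
  · rintro ⟨⟨x, hyx⟩, hA⟩
    rw [mem_preimage, hyx.flowMap_eq] at hA
    exact ⟨x, hA, by simpa using hyx.symm⟩

theorem measurableSet_flowImage [T2Space S] [MeasurableSpace S] [BorelSpace S]
    (X : TranslationSurface S) (t : ℝ) {A : Set S} (hA : MeasurableSet A) :
    MeasurableSet (X.flowImage t A) := by
  rw [flowImage_eq]
  exact (X.continuousOn_flowMap_right _).measurableSet_inter_preimage (X.isOpen_flowDomain _) hA

/-- Area is invariant under the translation flow, since the flow is locally a translation. -/
theorem isFlowInvariant_area [T2Space S] [SecondCountableTopology S] [MeasurableSpace S]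
    [BorelSpace S] (X : TranslationSurface S) : X.IsFlowInvariant X.area := by
  intro t A hA hAt
  have hmap : ∀ C, MeasurableSet C →
      Measure.map (X.flowMap (-t)) (X.area.restrict (X.flowDomain (-t))) C =
        X.area (X.flowImage t C) := fun C hC => by
    have hm := (X.isOpen_flowDomain (-t)).measurableSet
    rw [Measure.map_apply_of_aemeasurable ((X.continuousOn_flowMap_right _).aemeasurable hm) hC,
      Measure.restrict_apply' hm, flowImage_eq, inter_comm]
  rw [← hmap A hA]
  refine Measure.apply_eq_of_locally_eq (W := X.flowDomain t) (fun x ⟨y, hxy⟩ => ?_) hAt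
  obtain ⟨g, hg, hgf, hge⟩ := hxy.flowsNear
  obtain ⟨e, he, hx⟩ := hxy.left_mem_regularSet
  obtain ⟨e', he', hy⟩ := hxy.right_mem_regularSet
  obtain ⟨U, hU, hUo, hxU⟩ := eventually_nhds_iff.1 (((hgf.and (hge e e' he he' hx hy)).and
    (e.open_source.mem_nhds hx)).and (hg.eventually (e'.open_source.mem_nhds hy)))
  refine ⟨U, hUo, hxU, fun C hC hCU => ?_⟩
  rw [hmap C hC, he.area_apply hC fun u hu => (hU u (hCU hu)).1.2,
    he'.area_apply (X.measurableSet_flowImage t hC) ?_]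
  · rw [← measure_preimage_add_right volume (e' y - e x)
      (e'.target ∩ e'.symm ⁻¹' X.flowImage t C)]
    refine congrArg volume (Eq.symm ?_)
    ext z
    refine ⟨?_, ?_⟩
    · rintro ⟨hz, hzC⟩
      obtain ⟨⟨⟨hf, heq⟩, -⟩, hs⟩ := hU _ (hCU hzC)
      rw [e.right_inv hz] at heq
      have heq' : z + (e' y - e x) = e' (g (e.symm z)) := by linear_combination -heq
      refine ⟨?_, _, hzC, ?_⟩
      · change z + (e' y - e x) ∈ e'.target
        rw [heq']
        exact e'.map_source hs
      · change X.FlowsTo t (e.symm z) (e'.symm (z + (e' y - e x)))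
        rwa [heq', e'.left_inv hs]
    · rintro ⟨hz, u, hu, huv⟩
      obtain ⟨⟨⟨hf, heq⟩, hs⟩, -⟩ := hU _ (hCU hu)
      have hv : e' (g u) = z + (e' y - e x) := by rw [hf.unique huv, e'.right_inv hz]
      have hzu : z = e u := by linear_combination heq - hv
      rw [hzu]
      exact ⟨e.map_source hs, by rwa [mem_preimage, e.left_inv hs]⟩
  · rintro v ⟨u, hu, huv⟩
    rw [← (hU u (hCU hu)).1.1.1.unique huv]
    exact (hU u (hCU hu)).2

/-! ### Area and finite covers -/

section Cover

variable {S S' : Type*} [TopologicalSpace S] [ChartedSpace ℂ S]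
  [TopologicalSpace S'] [ChartedSpace ℂ S']
  {X : TranslationSurface S} {X' : TranslationSurface S'} {p : S' → S} {d : ℕ}

theorem IsFiniteCover.exists_sheet (hp : X'.IsFiniteCover X p d) (x : S') :
    ∃ q : OpenPartialHomeomorph S' S, x ∈ q.source ∧ p = q :=
  hp.isCoveringMap.isLocalHomeomorph x

theorem IsFiniteCover.isNaturalChart_trans (hp : X'.IsFiniteCover X p d)
    {q : OpenPartialHomeomorph S' S} (hq : p = q) {e : OpenPartialHomeomorph S ℂ}
    (he : X.IsNaturalChart e) : X'.IsNaturalChart (q.trans e) := by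
  subst hq
  intro x hx
  have hx' : x ∈ q.source ∧ q x ∈ e.source := by simpa using hx
  rw [hp.form_eq x]
  exact (he _ hx'.2).comp x (hp.mdifferentiable x).hasMFDerivAt

variable [IsManifold 𝓘(ℂ) 1 S] [IsManifold 𝓘(ℂ) 1 S']

/-- A natural chart upstairs descends along a sheet of the cover, because the inverse of the sheet
is holomorphic. -/
theorem IsFiniteCover.isNaturalChart_symm_trans (hp : X'.IsFiniteCover X p d)
    {q : OpenPartialHomeomorph S' S} (hq : p = q) {e : OpenPartialHomeomorph S' ℂ}
    (he : X'.IsNaturalChart e) : X.IsNaturalChart (q.symm.trans e) := by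
  subst hq
  intro y hy
  have hy' : y ∈ q.target ∧ q.symm y ∈ e.source := by simpa using hy
  have hqd := q.mdifferentiable_of_mdifferentiableOn hp.mdifferentiable.mdifferentiableOn
  have hs := (hqd.mdifferentiableAt_symm hy'.1).hasMFDerivAt
  refine ((he _ hy'.2).comp y hs).congr_mfderiv ?_
  have hform : ∀ z, z = y → (X.form z : ℂ →L[ℂ] ℂ) = X.form y := by
    rintro _ rfl
    rfl
  have hid := hqd.comp_symm_deriv hy'.1
  rw [hp.form_eq]
  exact (congrArg (fun L : ℂ →L[ℂ] ℂ => (X.form (q (q.symm y)) : ℂ →L[ℂ] ℂ).comp L) hid).trans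
    ((ContinuousLinearMap.comp_id _).trans (hform _ (q.right_inv hy'.1)))

theorem IsFiniteCover.preimage_regularSet (hp : X'.IsFiniteCover X p d) :
    p ⁻¹' X.regularSet = X'.regularSet := by
  ext x
  obtain ⟨q, hx, hq⟩ := hp.exists_sheet x
  constructor
  · rintro ⟨e, he, hxe⟩
    exact ⟨q.trans e, hp.isNaturalChart_trans hq he, by simpa [hx, ← hq] using hxe⟩
  · rintro ⟨e, he, hxe⟩
    refine ⟨q.symm.trans e, hp.isNaturalChart_symm_trans hq he, ?_⟩
    rw [hq]
    simpa [hx, q.map_source hx] using hxe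

variable [MeasurableSpace S] [BorelSpace S] [MeasurableSpace S'] [BorelSpace S']

/-- A sheet of the cover preserves area: composing it with a natural chart downstairs gives a natural
chart upstairs with the same values. -/
theorem IsFiniteCover.area_sheet (hp : X'.IsFiniteCover X p d)
    {q : OpenPartialHomeomorph S' S} (hq : p = q) {e : OpenPartialHomeomorph S ℂ}
    (he : X.IsNaturalChart e) {B : Set S} (hB : MeasurableSet B) (hBe : B ⊆ e.source)
    (hBq : B ⊆ q.target) : X'.area (q.source ∩ p ⁻¹' B) = X.area B := by
  have hm : MeasurableSet (q.source ∩ p ⁻¹' B) :=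
    q.open_source.measurableSet.inter (hp.isCoveringMap.continuous.measurable hB)
  subst hq
  rw [(hp.isNaturalChart_trans rfl he).area_apply hm (fun x hx => by simpa using ⟨hx.1, hBe hx.2⟩),
    he.area_apply hB hBe]
  congr 1
  ext w
  simp only [OpenPartialHomeomorph.trans_target, OpenPartialHomeomorph.coe_trans_symm,
    Function.comp_apply, mem_inter_iff, mem_preimage]
  constructor
  · rintro ⟨⟨hw, hwq⟩, -, hwB⟩
    rw [q.right_inv hwq] at hwB
    exact ⟨hw, hwB⟩
  · rintro ⟨hw, hwB⟩
    have hwq := hBq hwB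
    exact ⟨⟨hw, hwq⟩, q.map_target hwq, by rwa [q.right_inv hwq]⟩

/-- Small sets are evenly covered: over a neighbourhood of a regular point the cover is the
disjoint union of `d` sheets, found by counting points of the fibres. -/
theorem IsFiniteCover.map_area [SecondCountableTopology S] [T2Space S']
    (hp : X'.IsFiniteCover X p d) : Measure.map p X'.area = (d : ENNReal) • X.area := by
  have hpm : Measurable p := hp.isCoveringMap.continuous.measurable
  have hR := X.isOpen_regularSet.measurableSet
  have hfin : ∀ y, (p ⁻¹' {y}).Finite := fun y =>
    finite_of_ncard_pos (by rw [hp.ncard_fiber]; exact hp.degree_pos)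
  refine Measure.ext fun B hB => ?_
  rw [← measure_inter_add_sdiff B hR, ← measure_inter_add_sdiff B hR]
  congr 1
  · refine Measure.apply_eq_of_locally_eq (W := X.regularSet) (fun y ⟨e, he, hy⟩ => ?_)
      inter_subset_right
    obtain ⟨U, hU, hdisj⟩ := (hfin y).t2_separation
    choose q₀ hxq₀ hq₀ using hp.exists_sheet
    set q : S' → OpenPartialHomeomorph S' S := fun x => (q₀ x).restrOpen (U x) (hU x).2 with hqdef
    have hq : ∀ x, p = q x := fun x => by simpa [hqdef] using hq₀ x
    have hxq : ∀ x, x ∈ (q x).source := fun x => by simp [hqdef, hxq₀ x, (hU x).1]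
    have hqU : ∀ x, (q x).source ⊆ U x := fun x => by simp [hqdef]
    refine ⟨e.source ∩ ⋂ x ∈ p ⁻¹' {y}, (q x).target,
      e.open_source.inter ((hfin y).isOpen_biInter fun x _ => (q x).open_target),
      ⟨hy, mem_iInter₂.2 fun x hx => ?_⟩, fun C hC hCV => ?_⟩
    · have := (q x).map_source (hxq x)
      rwa [← hq x, show p x = y from hx] at this
    have hCq : ∀ x ∈ p ⁻¹' {y}, C ⊆ (q x).target := fun x hx u hu =>
      mem_iInter₂.1 (hCV hu).2 x hx
    have hdisj' : (p ⁻¹' {y}).PairwiseDisjoint fun x => (q x).source ∩ p ⁻¹' C :=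
      hdisj.mono fun x => inter_subset_left.trans (hqU x)
    have hcover : p ⁻¹' C = ⋃ x ∈ (hfin y).toFinset, (q x).source ∩ p ⁻¹' C := by
      refine Subset.antisymm (fun x' hx' => ?_) (iUnion₂_subset fun _ _ => inter_subset_right)
      have hinj : InjOn (fun x => (q x).symm (p x')) (p ⁻¹' {y}) := by
        intro a ha b hb hab
        by_contra hne
        refine disjoint_left.1 (hdisj ha hb hne) (hqU a ((q a).map_target (hCq a ha hx')))
          (hqU b ?_)
        have h := (q b).map_target (hCq b hb hx')
        exact (show (q a).symm (p x') = (q b).symm (p x') from hab) ▸ h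
      have himg : (fun x => (q x).symm (p x')) '' (p ⁻¹' {y}) = p ⁻¹' {p x'} := by
        refine eq_of_subset_of_ncard_le ?_ ?_ (hfin _)
        · rintro _ ⟨x, hx, rfl⟩
          have h := (q x).right_inv (hCq x hx hx')
          rwa [← hq x] at h
        · rw [hinj.ncard_image, hp.ncard_fiber, hp.ncard_fiber]
      obtain ⟨x, hx, hxx⟩ : x' ∈ (fun x => (q x).symm (p x')) '' (p ⁻¹' {y}) := by
        rw [himg]
        rfl
      refine mem_iUnion₂.2 ⟨x, by simpa using hx, ?_, hx'⟩
      rw [← hxx]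
      exact (q x).map_target (hCq x hx hx')
    rw [Measure.map_apply hpm hC, hcover, measure_biUnion_finset (by simpa using hdisj')
      fun x _ => (q x).open_source.measurableSet.inter (hpm hC),
      Finset.sum_congr rfl fun x hx => hp.area_sheet (hq x) he hC (fun u hu => (hCV hu).1)
        (hCq x (by simpa using hx))]
    rw [Finset.sum_const, ← ncard_eq_toFinset_card _ (hfin y), hp.ncard_fiber]
    simp
  · have h₁ : X.area (B \ X.regularSet) = 0 :=
      measure_mono_null (fun x hx => hx.2) X.area_compl_regularSet
    have h₂ : X'.area (p ⁻¹' (B \ X.regularSet)) = 0 := by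
      refine measure_mono_null (fun x hx => ?_) X'.area_compl_regularSet
      rw [← hp.preimage_regularSet]
      exact hx.2
    rw [Measure.map_apply hpm (hB.diff hR), h₂]
    simp [h₁]

/-- A measure that projects to one absolutely continuous with respect to area is absolutely
continuous, because each sheet of the cover carries null sets to null sets. -/
theorem IsFiniteCover.absolutelyContinuous [SecondCountableTopology S']
    (hp : X'.IsFiniteCover X p d) {μ : Measure S'} (hμ : Measure.map p μ ≪ X.area) :
    μ ≪ X'.area := by
  have hpm : Measurable p := hp.isCoveringMap.continuous.measurable
  have hR := X.isOpen_regularSet.measurableSet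
  refine Measure.AbsolutelyContinuous.mk fun A hA hA0 => ?_
  have hZ : μ X'.regularSetᶜ = 0 := by
    have := hμ X.area_compl_regularSet
    rwa [Measure.map_apply hpm hR.compl, preimage_compl, hp.preimage_regularSet] at this
  refine measure_mono_null (t := A ∩ X'.regularSet ∪ X'.regularSetᶜ) (fun x hx => ?_)
    (measure_union_null ?_ hZ)
  · by_cases h : x ∈ X'.regularSet
    · exact Or.inl ⟨hx, h⟩
    · exact Or.inr h
  refine measure_null_of_locally_null _ fun x hx => ?_
  obtain ⟨q, hxq, hq⟩ := hp.exists_sheet x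
  obtain ⟨e, he, hxe⟩ : p x ∈ X.regularSet := by
    have h := hx.2
    rwa [← hp.preimage_regularSet] at h
  have hW : IsOpen (q.source ∩ p ⁻¹' e.source) :=
    q.open_source.inter (e.open_source.preimage hp.isCoveringMap.continuous)
  refine ⟨A ∩ (q.source ∩ p ⁻¹' e.source), ?_, ?_⟩
  · exact inter_mem (mem_of_superset self_mem_nhdsWithin inter_subset_left)
      (mem_nhdsWithin_of_mem_nhds (hW.mem_nhds ⟨hxq, hxe⟩))
  set D := e.source ∩ (q.target ∩ q.symm ⁻¹' A) with hD
  have hDm : MeasurableSet D := e.open_source.measurableSet.inter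
    (q.continuousOn_symm.measurableSet_inter_preimage q.open_target hA)
  have hD0 : X.area D = 0 := by
    rw [← hp.area_sheet hq he hDm inter_subset_left fun u hu => hu.2.1]
    refine measure_mono_null (fun z hz => ?_) hA0
    have h : q.symm (p z) ∈ A := hz.2.2.2
    rwa [hq, q.left_inv hz.1] at h
  have hμD := hμ hD0
  rw [Measure.map_apply hpm hDm] at hμD
  refine measure_mono_null (t := p ⁻¹' D) (fun z hz => ⟨hz.2.2, ?_⟩) hμD
  rw [hq]
  exact ⟨q.map_source hz.2.1, by rw [mem_preimage, q.left_inv hz.2.1]; exact hz.1⟩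

end Cover

/-! ### Invariant densities -/

section Density

variable {S : Type*} [TopologicalSpace S] [T2Space S] [ChartedSpace ℂ S]
  [IsManifold 𝓘(ℂ) 1 S] {X : TranslationSurface S}

/-- The regular points whose trajectory lies in `A` at almost every time. This is a union of
orbits, and it equals `A` up to a null set if `A` is almost invariant. -/
def fullOrbits (X : TranslationSurface S) (A : Set S) : Set S :=
  {x | x ∈ X.regularSet ∧ ∀ᵐ t : ℝ, ∀ y, X.FlowsTo t x y → y ∈ A}

theorem FlowsTo.mem_fullOrbits {A : Set S} {t : ℝ} {x y : S} (h : X.FlowsTo t x y)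
    (hx : x ∈ X.fullOrbits A) : y ∈ X.fullOrbits A := by
  refine ⟨h.right_mem_regularSet, ?_⟩
  have hmp := (measurePreserving_add_left (volume : Measure ℝ) t).quasiMeasurePreserving.ae hx.2
  filter_upwards [hmp] with s hs z hz
  exact hs z (h.trans hz)

variable [MeasurableSpace S] [BorelSpace S]

theorem measurableSet_inter_flowMap (X : TranslationSurface S) (t : ℝ) {A : Set S}
    (hA : MeasurableSet A) : MeasurableSet (X.flowDomain t ∩ X.flowMap t ⁻¹' A) :=
  (X.continuousOn_flowMap_right t).measurableSet_inter_preimage (X.isOpen_flowDomain t) hA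

variable [SecondCountableTopology S]

theorem measurableSet_flowSet_inter (X : TranslationSurface S) {A : Set S}
    (hA : MeasurableSet A) :
    MeasurableSet (X.flowSet ∩ (fun q : ℝ × S => X.flowMap q.1 q.2) ⁻¹' A) :=
  X.continuousOn_flowMap.measurableSet_inter_preimage X.isOpen_flowSet hA

/-- The set where an invariant measure has density greater than `1` with respect to another one
loses only a null set under the flow: the lost part `B` has `μ B > ν B` unless it is null, while
its image `C` lies where the density is at most `1`, so `μ C ≤ ν C`. -/
theorem IsFlowInvariant.measure_leaving_eq_zero {μ ν : Measure S} [IsFiniteMeasure μ]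
    [IsFiniteMeasure ν] (hμ : X.IsFlowInvariant μ) (hν : X.IsFlowInvariant ν) (hμν : μ ≪ ν)
    (t : ℝ) :
    ν ({x | 1 < μ.rnDeriv ν x} ∩
      (X.flowDomain t ∩ X.flowMap t ⁻¹' {x | 1 < μ.rnDeriv ν x}ᶜ)) = 0 := by
  set f := μ.rnDeriv ν with hf
  set A : Set S := {x | 1 < f x} with hAdef
  have hfm : Measurable f := Measure.measurable_rnDeriv μ ν
  have hA : MeasurableSet A := measurableSet_lt measurable_const hfm
  set B := A ∩ (X.flowDomain t ∩ X.flowMap t ⁻¹' Aᶜ) with hB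
  have hBm : MeasurableSet B := hA.inter (X.measurableSet_inter_flowMap t hA.compl)
  have hBt : B ⊆ X.flowDomain t := fun x hx => hx.2.1
  have hCm := X.measurableSet_flowImage t hBm
  have hle : μ B ≤ ν B := by
    rw [← hμ t B hBm hBt, ← hν t B hBm hBt, ← Measure.setLIntegral_rnDeriv hμν]
    refine (setLIntegral_mono measurable_const (g := fun _ => 1) fun y hy => ?_).trans_eq (by simp)
    obtain ⟨x, hx, hxy⟩ := hy
    have h : X.flowMap t x ∉ A := hx.2.2
    rw [hxy.flowMap_eq] at h
    exact not_lt.1 h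
  have hae : (fun _ => 1) =ᵐ[ν.restrict B] f := by
    refine ae_eq_of_ae_le_of_lintegral_le ?_ (by simp) hfm.aemeasurable ?_
    · filter_upwards [ae_restrict_mem hBm] with x hx using le_of_lt hx.1
    · rw [Measure.setLIntegral_rnDeriv hμν]
      simpa using hle
  have hfalse : ∀ᵐ x ∂ν.restrict B, False := by
    filter_upwards [hae, ae_restrict_mem hBm] with x hx hxB
    have h : 1 < f x := hxB.1
    exact h.ne hx
  simpa [ae_iff] using hfalse

theorem IsFlowInvariant.ae_mem_iff {μ ν : Measure S} [IsFiniteMeasure μ] [IsFiniteMeasure ν]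
    (hμ : X.IsFlowInvariant μ) (hν : X.IsFlowInvariant ν) (hμν : μ ≪ ν) (t : ℝ) :
    ∀ᵐ x ∂ν, ∀ y, X.FlowsTo t x y → (1 < μ.rnDeriv ν x ↔ 1 < μ.rnDeriv ν y) := by
  set A : Set S := {x | 1 < μ.rnDeriv ν x} with hAdef
  have hA : MeasurableSet A := measurableSet_lt measurable_const (Measure.measurable_rnDeriv μ ν)
  have h₁ := hμ.measure_leaving_eq_zero hν hμν t
  have h₂ : ν (Aᶜ ∩ (X.flowDomain t ∩ X.flowMap t ⁻¹' A)) = 0 := by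
    -- the part entering `A` is carried by the flow onto a part that leaves `A` in backward time
    rw [← hν t _ (hA.compl.inter (X.measurableSet_inter_flowMap t hA)) fun x hx => hx.2.1]
    refine measure_mono_null ?_ (hμ.measure_leaving_eq_zero hν hμν (-t))
    rintro y ⟨x, ⟨hx, -, hxA⟩, hxy⟩
    rw [mem_preimage, hxy.flowMap_eq] at hxA
    exact ⟨hxA, ⟨x, hxy.symm⟩, by rwa [mem_preimage, hxy.symm.flowMap_eq]⟩
  filter_upwards [measure_eq_zero_iff_ae_notMem.1 h₁, measure_eq_zero_iff_ae_notMem.1 h₂]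
    with x hx₁ hx₂ y hxy
  constructor
  · intro hx
    by_contra hy
    exact hx₁ ⟨hx, ⟨y, hxy⟩, by rwa [mem_preimage, hxy.flowMap_eq]⟩
  · intro hy
    by_contra hx
    exact hx₂ ⟨hx, ⟨y, hxy⟩, by rwa [mem_preimage, hxy.flowMap_eq]⟩

theorem measurableSet_fullOrbits (X : TranslationSurface S) {A : Set S} (hA : MeasurableSet A) :
    MeasurableSet (X.fullOrbits A) := by
  have hm := measurable_measure_prodMk_right (μ := (volume : Measure ℝ))
    (X.measurableSet_flowSet_inter hA.compl)
  refine X.isOpen_regularSet.measurableSet.inter ?_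
  refine (congrArg MeasurableSet (ext fun x => ?_)).mp (hm (measurableSet_singleton 0))
  refine Iff.symm (show (∀ᵐ t : ℝ, ∀ y, X.FlowsTo t x y → y ∈ A) ↔ _ from ?_)
  rw [mem_preimage, mem_singleton_iff, measure_eq_zero_iff_ae_notMem]
  refine eventually_congr (Eventually.of_forall fun t => ?_)
  constructor
  · rintro h ⟨⟨y, hy⟩, hyA⟩
    exact hyA (by simpa only [hy.flowMap_eq] using h y hy)
  · intro h y hy
    by_contra hyA
    exact h ⟨⟨y, hy⟩, by simpa only [mem_preimage, hy.flowMap_eq, mem_compl_iff] using hyA⟩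

theorem ae_mem_fullOrbits_iff {ν : Measure S} [IsFiniteMeasure ν] (hν : ν ≪ X.area) {A : Set S}
    (hA : MeasurableSet A)
    (hAinv : ∀ t : ℝ, ∀ᵐ x ∂ν, ∀ y, X.FlowsTo t x y → (x ∈ A ↔ y ∈ A)) :
    ∀ᵐ x ∂ν, x ∈ X.fullOrbits A ↔ x ∈ A := by
  have hmeas : MeasurableSet {q : ℝ × S | ∀ y, X.FlowsTo q.1 q.2 y → (q.2 ∈ A ↔ y ∈ A)} := by
    have h₁ := (X.measurableSet_flowSet_inter hA).inter (measurable_snd hA.compl)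
    have h₂ := (X.measurableSet_flowSet_inter hA.compl).inter (measurable_snd hA)
    convert (h₁.union h₂).compl using 1
    ext ⟨t, x⟩
    simp only [mem_ofPred_eq, mem_compl_iff, mem_union, mem_inter_iff, mem_preimage, flowSet,
      flowDomain]
    constructor
    · rintro h (⟨⟨⟨y, hy⟩, hyA⟩, hx⟩ | ⟨⟨⟨y, hy⟩, hyA⟩, hx⟩)
      · rw [hy.flowMap_eq] at hyA
        exact hx ((h y hy).2 hyA)
      · rw [hy.flowMap_eq] at hyA
        exact hyA ((h y hy).1 hx)
    · intro h y hy
      rw [hy.flowMap_eq] at h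
      have hex : ∃ y, X.FlowsTo t x y := ⟨y, hy⟩
      tauto
  have hswap := (Measure.ae_ae_comm (μ := (volume : Measure ℝ)) (ν := ν)
    (p := fun t x => ∀ y, X.FlowsTo t x y → (x ∈ A ↔ y ∈ A)) hmeas).1
    (Eventually.of_forall hAinv)
  filter_upwards [hswap, measure_eq_zero_iff_ae_notMem.1 (hν X.area_compl_regularSet)]
    with x hx hxR
  rw [notMem_compl_iff] at hxR
  constructor
  · rintro ⟨-, hG⟩
    by_contra hxA
    have hout : ∀ᵐ t : ℝ, t ∉ {t : ℝ | x ∈ X.flowDomain t} := by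
      filter_upwards [hx, hG] with t ht htG
      rintro ⟨y, hy⟩
      exact hxA ((ht y hy).2 (htG y hy))
    have hopen : IsOpen {t : ℝ | x ∈ X.flowDomain t} :=
      X.isOpen_flowSet.preimage (Continuous.prodMk_left x)
    -- the flow is defined at `x` for short times, which form a set of positive measure
    exact (hopen.measure_pos volume ⟨0, x, FlowsTo.refl hxR⟩).ne'
      (measure_eq_zero_iff_ae_notMem.2 hout)
  · intro hxA
    refine ⟨hxR, ?_⟩
    filter_upwards [hx] with t ht y hy using (ht y hy).1 hxA

/-- For an ergodic translation flow, two invariant finite measures of equal mass coincide if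
one is absolutely continuous with respect to the other, and that one with respect to area: the set
where the density is greater than `1` agrees with a union of orbits, so the density is either at
most `1` or at least `1` almost everywhere. -/
theorem HasErgodicFlow.eq_of_absolutelyContinuous (hX : X.HasErgodicFlow) {μ ν : Measure S}
    [IsFiniteMeasure μ] [IsFiniteMeasure ν] (hμ : X.IsFlowInvariant μ) (hν : X.IsFlowInvariant ν)
    (hμν : μ ≪ ν) (hνX : ν ≪ X.area) (huniv : μ univ = ν univ) : μ = ν := by
  set A : Set S := {x | 1 < μ.rnDeriv ν x} with hAdef
  have hA : MeasurableSet A := measurableSet_lt measurable_const (Measure.measurable_rnDeriv μ ν)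
  have hG := ae_mem_fullOrbits_iff hνX hA (hμ.ae_mem_iff hν hμν)
  have hd : ν.withDensity (μ.rnDeriv ν) = μ := Measure.withDensity_rnDeriv_eq μ ν hμν
  have hone : ν.withDensity 1 = ν := withDensity_one
  rcases hX (X.fullOrbits A) (X.measurableSet_fullOrbits hA)
    (fun t x y h => ⟨h.mem_fullOrbits, h.symm.mem_fullOrbits⟩) with h | h
  · have hle : μ ≤ ν := by
      rw [← hd]
      refine (withDensity_mono ?_).trans_eq hone
      filter_upwards [hG, measure_eq_zero_iff_ae_notMem.1 (hνX h)] with x hx hxG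
      exact not_lt.1 fun hlt => hxG (hx.2 hlt)
    exact Measure.eq_of_le_of_measure_univ_eq hle huniv
  · have hle : ν ≤ μ := by
      rw [← hd]
      refine hone.symm.le.trans (withDensity_mono ?_)
      filter_upwards [hG, measure_eq_zero_iff_ae_notMem.1 (hνX h)] with x hx hxG
      exact le_of_lt (hx.1 (notMem_compl_iff.1 hxG))
    exact (Measure.eq_of_le_of_measure_univ_eq hle huniv.symm).symm

theorem isFlowInvariant_lebesgue (X : TranslationSurface S) : X.IsFlowInvariant X.lebesgue :=
  fun t A hA hAt => by
    simp only [lebesgue, Measure.smul_apply, X.isFlowInvariant_area t A hA hAt]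

instance isFiniteMeasure_lebesgue (X : TranslationSurface S) : IsFiniteMeasure X.lebesgue :=
  ⟨by simpa [lebesgue] using (ENNReal.inv_mul_le_one (X.area univ)).trans_lt ENNReal.one_lt_top⟩

end Density

theorem IsFiniteCover.map_lebesgue {S S' : Type*} [TopologicalSpace S] [ChartedSpace ℂ S]
    [IsManifold 𝓘(ℂ) 1 S] [TopologicalSpace S'] [ChartedSpace ℂ S'] [IsManifold 𝓘(ℂ) 1 S']
    [MeasurableSpace S] [BorelSpace S] [MeasurableSpace S'] [BorelSpace S']
    [SecondCountableTopology S] [T2Space S'] {X : TranslationSurface S}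
    {X' : TranslationSurface S'} {p : S' → S} {d : ℕ} (hp : X'.IsFiniteCover X p d) :
    Measure.map p X'.lebesgue = X.lebesgue := by
  have hpm : Measurable p := hp.isCoveringMap.continuous.measurable
  have hd : (d : ENNReal) ≠ 0 := by exact_mod_cast hp.degree_pos.ne'
  have hd' : (d : ENNReal) ≠ ⊤ := ENNReal.natCast_ne_top d
  have huniv : X'.area univ = d * X.area univ := by
    have h := congrArg (fun m => m univ) hp.map_area
    simpa [Measure.map_apply hpm] using h
  rw [lebesgue, lebesgue, Measure.map_smul, hp.map_area, huniv, smul_smul,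
    ENNReal.mul_inv (Or.inl hd) (Or.inl hd'), mul_comm (d : ENNReal)⁻¹, mul_assoc,
    ENNReal.inv_mul_cancel hd hd', mul_one]

end TranslationSurface

theorem mainTheorem5
    {S S' : Type*}
    [TopologicalSpace S] [T2Space S] [SecondCountableTopology S] [ConnectedSpace S]
    [ChartedSpace ℂ S] [IsManifold 𝓘(ℂ) ω S] [MeasurableSpace S] [BorelSpace S]
    [TopologicalSpace S'] [T2Space S'] [SecondCountableTopology S']
    [ChartedSpace ℂ S'] [IsManifold 𝓘(ℂ) ω S'] [MeasurableSpace S'] [BorelSpace S']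
    (X : TranslationSurface S) (X' : TranslationSurface S')
    (hArea : X.area Set.univ < ⊤)
    (hType : HasInfiniteTopologicalType S)
    (p : S' → S) (d : ℕ) (hp : X'.IsFiniteCover X p d)
    (hErg : X.HasErgodicFlow) (hErg' : X'.HasErgodicFlow) :
    (X'.IsFlowInvariant X'.lebesgue ∧ Measure.map p X'.lebesgue = X.lebesgue) ∧
      ∀ μ : Measure S', X'.IsFlowInvariant μ → Measure.map p μ = X.lebesgue →
        μ = X'.lebesgue := by
  have : IsManifold 𝓘(ℂ) 1 S := IsManifold.of_le (n := ω) le_top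
  have : IsManifold 𝓘(ℂ) 1 S' := IsManifold.of_le (n := ω) le_top
  have hpm : Measurable p := hp.isCoveringMap.continuous.measurable
  refine ⟨⟨X'.isFlowInvariant_lebesgue, hp.map_lebesgue⟩, fun μ hμ hμp => ?_⟩
  have huniv : μ univ = X'.lebesgue univ := by
    have h := congrArg (fun m => m univ) (hμp.trans hp.map_lebesgue.symm)
    simpa [Measure.map_apply hpm] using h
  have : IsFiniteMeasure μ := ⟨huniv ▸ measure_lt_top _ _⟩
  have hArea' : X'.area univ ≠ ⊤ := by
    have h := congrArg (fun m => m univ) hp.map_area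
    rw [Measure.map_apply hpm MeasurableSet.univ, preimage_univ] at h
    rw [h, Measure.smul_apply, smul_eq_mul]
    exact ENNReal.mul_ne_top (ENNReal.natCast_ne_top d) hArea.ne
  have hμX : μ ≪ X'.area :=
    hp.absolutelyContinuous (hμp ▸ Measure.smul_absolutelyContinuous)
  exact hErg'.eq_of_absolutelyContinuous hμ X'.isFlowInvariant_lebesgue
    (hμX.trans (Measure.absolutelyContinuous_smul (ENNReal.inv_ne_zero.2 hArea')))
    Measure.smul_absolutelyContinuous huniv
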